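/- Let $\mathbf{C}^*$ be the category of complex, not necessarily unital, $C^*$-algebras and $*$-homomorphisms, and let $\otimes$ be the maximal tensor product of $C^*$-algebras. "Endofunctor" means endofunctor of $\mathbf{C}^*$. For $A\in\mathbf{C}^*$ let $\mathfrak{D}_A=A\otimes(-)$, and for a $*$-homomorphism $\varphi:A\to A'$ let $\mathfrak{D}_\varphi:\mathfrak{D}_A\Rightarrow\mathfrak{D}_{A'}$ be the natural transformation with components $\varphi\otimes B$. Let $\mathfrak{D}^2_{A,A'}:\mathfrak{D}_A\mathfrak{D}_{A'}\Rightarrow\mathfrak{D}_{A\otimes A'}$ have components $A\otimes(A'\otimes B)\to(A\otimes A')\otimes B$, $a\otimes(a'\otimes b)\mapsto(a\otimes a')\otimes b$, and let $\mathfrak{D}^0:\mathrm{Id}\Rightarrow\mathfrak{D}_{\mathbb{C}}$ have components $B\to\mathbb{C}\otimes B$, $b\mapsto 1\otimes b$. A *labeling* of an endofunctor $F$ is a family of natural transformations $\kappa^{A,F}:\mathfrak{D}_AF\Rightarrow F\mathfrak{D}_A$, $A\in\mathbf{C}^*$, such that for all $\varphi:A\to A'$ and all $A,A'$ $$F\mathfrak{D}_\varphi\circ\kappa^{A,F}=\kappa^{A',F}\circ\mathfrak{D}_\varphi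 F,\qquad F\mathfrak{D}^2_{A,A'}\circ\kappa^{A,F}\mathfrak{D}_{A'}\circ\mathfrak{D}_A\kappa^{A',F}=\kappa^{A\otimes A',F}\circ\mathfrak{D}^2_{A,A'}F,\qquad \kappa^{\mathbb{C},F}\circ\mathfrak{D}^0F=F\mathfrak{D}^0 .$$ A *labeled endofunctor* is an endofunctor together with a labeling. A natural transformation $\alpha:F\Rightarrow G$ between labeled endofunctors is *labeled* if $\alpha\mathfrak{D}_A\circ\kappa^{A,F}=\kappa^{A,G}\circ\mathfrak{D}_A\alpha$ for all $A$. An endofunctor is *decent* if it preserves the terminal object $0$ and every pullback of a pair $B_1\xrightarrow{\varphi_1}B\xleftarrow{\varphi_2}B_2$ in which $\varphi_2$ is a split epimorphism. A *good endofunctor* is a labeled endofunctor whose underlying endofunctor is decent, and $\mathrm{GEFC}$ is the category of good endofunctors and labeled natural transformations. **Proposition 4.20.** The category $\mathrm{GEFC}$ is complete, that is, it has all small limits, and these are computed componentwise: 1. for every $B\in\mathbf{C}^*$ the functor $\mathrm{GEFC}\to\mathbf{C}^*$, $F\mapsto FB$, preserves small limits; 2. let $F_\bullet:\mathcal{J}\to\mathrm{GEFC}$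 be a small diagram and let $(\mathrm{pr}_j:F_\infty\Rightarrow F_j)_j$ be a cone over the diagram of underlying endofunctors such that $(\mathrm{pr}_jB:F_\infty B\to F_jB)_j$ is a limit cone in $\mathbf{C}^*$ for every $B$. Then there is a unique family of natural transformations $\kappa^A:\mathfrak{D}_AF_\infty\Rightarrow F_\infty\mathfrak{D}_A$ with $\mathrm{pr}_j\mathfrak{D}_A\circ\kappa^A=\kappa^{A,F_j}\circ\mathfrak{D}_A\mathrm{pr}_j$ for all $j$ and $A$; this family is a labeling of $F_\infty$, the endofunctor $F_\infty$ is decent, and $(F_\infty,\{\kappa^A\}_A)$ with the legs $\mathrm{pr}_j$ is a limit of $F_\bullet$ in $\mathrm{GEFC}$. -/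

import Mathlib

open CategoryTheory CategoryTheory.Limits
open scoped TensorProduct

universe u

noncomputable section

/-! ### C⋆-seminorms and the C⋆-algebra obtained from one by separation and completion -/

theorem continuous_hom {A D : Type u} [NonUnitalCStarAlgebra A] [NonUnitalCStarAlgebra D]
    (f : A →⋆ₙₐ[ℂ] D) : Continuous f :=
  (NonUnitalStarAlgHom.instContinuousLinearMapClassComplex (F := A →⋆ₙₐ[ℂ] D)).map_continuous f

/-- A C⋆-seminorm on a complex ⋆-algebra: a submultiplicative seminorm with
`p (x⋆ x) = (p x) ^ 2`. -/
structure CStarSeminorm (E : Type u) [NonUnitalRing E] [StarRing E] [Module ℂ E] extends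
    Seminorm ℂ E where
  mul_le' : ∀ x y, toFun (x * y) ≤ toFun x * toFun y
  star_mul_self' : ∀ x, toFun (star x * x) = toFun x ^ 2

namespace CStarSeminorm

section Completion

variable {E : Type u} [NonUnitalRing E] [StarRing E] [Module ℂ E]

instance : CoeFun (CStarSeminorm E) (fun _ => E → ℝ) := ⟨fun p => p.toSeminorm⟩

variable (p : CStarSeminorm E)

theorem mul_le (x y : E) : p (x * y) ≤ p x * p y := p.mul_le' x y

theorem star_mul_self (x : E) : p (star x * x) = p x ^ 2 := p.star_mul_self' x

theorem le_star (x : E) : p x ≤ p (star x) := by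
  by_cases h : p x = 0
  · rw [h]; exact apply_nonneg _ _
  · have h0 : 0 < p x := lt_of_le_of_ne (apply_nonneg _ _) (Ne.symm h)
    have h1 := p.mul_le (star x) x
    rw [p.star_mul_self, sq] at h1
    exact le_of_mul_le_mul_right h1 h0

theorem map_star (x : E) : p (star x) = p x :=
  le_antisymm (by simpa using p.le_star (star x)) (p.le_star x)

/-- The ⋆-algebra `E`, regarded as a seminormed space through the C⋆-seminorm `p`. -/
def Pre (_p : CStarSeminorm E) : Type u := E

instance : NonUnitalRing p.Pre := inferInstanceAs (NonUnitalRing E)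
instance : StarRing p.Pre := inferInstanceAs (StarRing E)
instance : Module ℂ p.Pre := inferInstanceAs (Module ℂ E)
instance [IsScalarTower ℂ E E] : IsScalarTower ℂ p.Pre p.Pre :=
  inferInstanceAs (IsScalarTower ℂ E E)
instance [SMulCommClass ℂ E E] : SMulCommClass ℂ p.Pre p.Pre :=
  inferInstanceAs (SMulCommClass ℂ E E)
instance [StarModule ℂ E] : StarModule ℂ p.Pre := inferInstanceAs (StarModule ℂ E)

instance : NonUnitalSeminormedRing p.Pre :=
  { (inferInstance : NonUnitalRing p.Pre),
    (p.toSeminorm.toAddGroupSeminorm :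
      AddGroupSeminorm E).toSeminormedAddCommGroup.toPseudoMetricSpace with
    norm := fun x : E => p x
    dist_eq := fun x y => (p.toSeminorm.toAddGroupSeminorm :
      AddGroupSeminorm E).toSeminormedAddCommGroup.dist_eq x y
    norm_mul_le := p.mul_le }

instance : NormedSpace ℂ p.Pre where
  norm_smul_le c x := (map_smul_eq_mul p.toSeminorm c x).le

instance : NormedStarGroup p.Pre where
  norm_star_le x := (p.map_star x).le

/-- The completion of the quotient of `E` by the null space of `p`. -/
def Completion : Type u := UniformSpace.Completion p.Pre

instance : NormedAddCommGroup p.Completion :=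
  inferInstanceAs (NormedAddCommGroup (UniformSpace.Completion p.Pre))
instance : NormedSpace ℂ p.Completion :=
  inferInstanceAs (NormedSpace ℂ (UniformSpace.Completion p.Pre))
instance : CompleteSpace p.Completion :=
  inferInstanceAs (CompleteSpace (UniformSpace.Completion p.Pre))

/-- The canonical linear map from `E` to the completion. -/
def coeL : E →ₗ[ℂ] p.Completion where
  toFun x := ((show p.Pre from x : p.Pre) : UniformSpace.Completion p.Pre)
  map_add' x y := UniformSpace.Completion.coe_add (α := p.Pre) x y
  map_smul' c x := UniformSpace.Completion.coe_smul (X := p.Pre) c x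

theorem norm_coeL (x : E) : ‖p.coeL x‖ = p x :=
  UniformSpace.Completion.norm_coe (E := p.Pre) x

theorem denseRange_coeL : DenseRange p.coeL :=
  UniformSpace.Completion.denseRange_coe (α := p.Pre)

theorem isDenseInducing_coe :
    IsDenseInducing ((↑) : p.Pre → UniformSpace.Completion p.Pre) :=
  UniformSpace.Completion.isDenseInducing_coe

instance : Mul p.Completion where
  mul := Function.curry <| (p.isDenseInducing_coe.prodMap p.isDenseInducing_coe).extend
    ((fun x : p.Pre => (x : UniformSpace.Completion p.Pre)) ∘
      Function.uncurry (fun x y : p.Pre => x * y))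

instance : Star p.Completion where
  star := UniformSpace.Completion.map (star : p.Pre → p.Pre)

theorem coeL_mul (x y : E) : p.coeL (x * y) = p.coeL x * p.coeL y :=
  ((p.isDenseInducing_coe.prodMap p.isDenseInducing_coe).extend_eq
      ((UniformSpace.Completion.continuous_coe p.Pre).comp
        (continuous_mul (M := p.Pre))) (x, y)).symm

theorem coeL_star (x : E) : p.coeL (star x) = star (p.coeL x) :=
  (UniformSpace.Completion.map_coe (α := p.Pre) (β := p.Pre) (f := star)
    (star_isometry (E := p.Pre)).uniformContinuous x).symm

theorem continuous_mul_completion : Continuous fun z : p.Completion × p.Completion => z.1 * z.2 := by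
  let m := (AddMonoidHom.mul : p.Pre →+ p.Pre →+ p.Pre).compr₂ UniformSpace.Completion.toCompl
  have : Continuous fun z : p.Pre × p.Pre => m z.1 z.2 :=
    (UniformSpace.Completion.continuous_coe p.Pre).comp (continuous_mul (M := p.Pre))
  have di : IsDenseInducing (UniformSpace.Completion.toCompl : p.Pre → _) := p.isDenseInducing_coe
  exact (di.extend_Z_bilin di this :)

instance : ContinuousMul p.Completion := ⟨p.continuous_mul_completion⟩

instance : ContinuousStar p.Completion := ⟨UniformSpace.Completion.continuous_map⟩

@[elab_as_elim]
theorem induction {P : p.Completion → Prop} (x : p.Completion) (hc : IsClosed {x | P x})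
    (h : ∀ x : E, P (p.coeL x)) : P x :=
  UniformSpace.Completion.induction_on (α := p.Pre) x hc h

@[elab_as_elim]
theorem induction₂ {P : p.Completion → p.Completion → Prop} (x y : p.Completion)
    (hc : IsClosed {z : p.Completion × p.Completion | P z.1 z.2})
    (h : ∀ x y : E, P (p.coeL x) (p.coeL y)) : P x y :=
  UniformSpace.Completion.induction_on₂ (α := p.Pre) (β := p.Pre) x y hc h

@[elab_as_elim]
theorem induction₃ {P : p.Completion → p.Completion → p.Completion → Prop}
    (x y z : p.Completion)
    (hc : IsClosed {z : p.Completion × p.Completion × p.Completion | P z.1 z.2.1 z.2.2})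
    (h : ∀ x y z : E, P (p.coeL x) (p.coeL y) (p.coeL z)) : P x y z :=
  UniformSpace.Completion.induction_on₃ (α := p.Pre) (β := p.Pre) (γ := p.Pre) x y z hc h

instance : NonUnitalNormedRing p.Completion :=
  { (inferInstance : NormedAddCommGroup p.Completion), (inferInstance : Mul p.Completion) with
    zero_mul := fun a => p.induction a (isClosed_eq (by fun_prop) (by fun_prop)) fun a => by
      rw [← map_zero p.coeL, ← p.coeL_mul, zero_mul]
    mul_zero := fun a => p.induction a (isClosed_eq (by fun_prop) (by fun_prop)) fun a => by
      rw [← map_zero p.coeL, ← p.coeL_mul, mul_zero]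
    mul_assoc := fun a b c => p.induction₃ a b c (isClosed_eq (by fun_prop) (by fun_prop))
      fun a b c => by simp only [← p.coeL_mul, mul_assoc]
    left_distrib := fun a b c => p.induction₃ a b c (isClosed_eq (by fun_prop) (by fun_prop))
      fun a b c => by simp only [← p.coeL_mul, ← map_add, mul_add]
    right_distrib := fun a b c => p.induction₃ a b c (isClosed_eq (by fun_prop) (by fun_prop))
      fun a b c => by simp only [← p.coeL_mul, ← map_add, add_mul]
    norm_mul_le := fun a b => p.induction₂ a b (isClosed_le (by fun_prop) (by fun_prop))
      fun a b => by rw [← p.coeL_mul]; simp only [p.norm_coeL]; exact p.mul_le a b }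

instance : StarRing p.Completion where
  star_involutive := fun a => p.induction a (isClosed_eq (by fun_prop) (by fun_prop)) fun a => by
    simp only [← p.coeL_star, star_star]
  star_mul := fun a b => p.induction₂ a b (isClosed_eq (by fun_prop) (by fun_prop)) fun a b => by
    simp only [← p.coeL_star, ← p.coeL_mul, star_mul]
  star_add := fun a b => p.induction₂ a b (isClosed_eq (by fun_prop) (by fun_prop)) fun a b => by
    simp only [← p.coeL_star, ← map_add, star_add]

instance : CStarRing p.Completion where
  norm_mul_self_le := fun a => p.induction a (isClosed_le (by fun_prop) (by fun_prop)) fun a => by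
    rw [← p.coeL_star, ← p.coeL_mul, p.norm_coeL, p.norm_coeL, p.star_mul_self, sq]

instance [IsScalarTower ℂ E E] : IsScalarTower ℂ p.Completion p.Completion where
  smul_assoc := fun c a b => p.induction₂ a b
    (isClosed_eq ((continuous_fst.const_smul c).mul continuous_snd)
      ((continuous_fst.mul continuous_snd).const_smul c)) fun a b => by
    rw [smul_eq_mul, smul_eq_mul, ← map_smul, ← p.coeL_mul, ← p.coeL_mul, ← map_smul,
      smul_mul_assoc]

instance [SMulCommClass ℂ E E] : SMulCommClass ℂ p.Completion p.Completion where
  smul_comm := fun c a b => p.induction₂ a b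
    (isClosed_eq ((continuous_fst.mul continuous_snd).const_smul c)
      (continuous_fst.mul (continuous_snd.const_smul c))) fun a b => by
    rw [smul_eq_mul, smul_eq_mul, ← map_smul, ← p.coeL_mul, ← p.coeL_mul, ← map_smul,
      mul_smul_comm]

instance [StarModule ℂ E] : StarModule ℂ p.Completion where
  star_smul := fun c a => p.induction a
    (isClosed_eq (continuous_star.comp (continuous_id.const_smul c))
      (Continuous.const_smul continuous_star (star c) : Continuous fun x => star c • star x)) fun a => by
    rw [← map_smul, ← p.coeL_star, ← p.coeL_star, ← map_smul, star_smul]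

instance [IsScalarTower ℂ E E] [SMulCommClass ℂ E E] [StarModule ℂ E] :
    NonUnitalCStarAlgebra p.Completion where

/-- The canonical ⋆-homomorphism from `E` to the completion. -/
def coe : E →⋆ₙₐ[ℂ] p.Completion where
  toFun := p.coeL
  map_smul' := map_smul p.coeL
  map_zero' := map_zero p.coeL
  map_add' := map_add p.coeL
  map_mul' := p.coeL_mul
  map_star' := p.coeL_star

theorem coe_apply (x : E) : p.coe x = p.coeL x := rfl

variable {D : Type u} [NonUnitalCStarAlgebra D]

/-- Extension of a bounded linear map to the completion. -/
def extendL (f : E →ₗ[ℂ] D) : p.Completion →L[ℂ] D := f.extendOfNorm p.coeL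

theorem extendL_coeL (f : E →ₗ[ℂ] D) (hf : ∃ C, ∀ x, ‖f x‖ ≤ C * p x) (x : E) :
    p.extendL f (p.coeL x) = f x :=
  LinearMap.extendOfNorm_eq p.denseRange_coeL
    (by obtain ⟨C, h⟩ := hf; exact ⟨C, fun x => by rw [p.norm_coeL]; exact h x⟩) x

/-- Extension of a ⋆-homomorphism to the completion. -/
def lift (π : E →⋆ₙₐ[ℂ] D) (hπ : ∀ x, ‖π x‖ ≤ p x) : p.Completion →⋆ₙₐ[ℂ] D :=
  have key : ∀ x, p.extendL (π : E →ₗ[ℂ] D) (p.coeL x) = π x :=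
    p.extendL_coeL _ ⟨1, fun x => by rw [one_mul]; exact hπ x⟩
  { toFun := p.extendL (π : E →ₗ[ℂ] D)
    map_smul' := map_smul (p.extendL (π : E →ₗ[ℂ] D))
    map_zero' := map_zero (p.extendL (π : E →ₗ[ℂ] D))
    map_add' := map_add (p.extendL (π : E →ₗ[ℂ] D))
    map_mul' := fun a b => p.induction₂ a b (isClosed_eq (by fun_prop) (by fun_prop))
      fun a b => by rw [← p.coeL_mul, key, key, key, map_mul]
    map_star' := fun a => p.induction a (isClosed_eq (by fun_prop) (by fun_prop))
      fun a => by rw [← p.coeL_star, key, key, StarHomClass.map_star] }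

theorem lift_coe (π : E →⋆ₙₐ[ℂ] D) (hπ : ∀ x, ‖π x‖ ≤ p x) (x : E) :
    p.lift π hπ (p.coe x) = π x :=
  p.extendL_coeL (π : E →ₗ[ℂ] D) ⟨1, fun x => by rw [one_mul]; exact hπ x⟩ x

theorem hom_ext [IsScalarTower ℂ E E] [SMulCommClass ℂ E E] [StarModule ℂ E]
    {f g : p.Completion →⋆ₙₐ[ℂ] D} (h : ∀ x, f (p.coe x) = g (p.coe x)) : f = g := by
  ext a
  exact p.induction a (isClosed_eq (continuous_hom f) (continuous_hom g)) h

/-- The C⋆-seminorm `x ↦ ‖π x‖` attached to a ⋆-homomorphism into a C⋆-algebra. -/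
def ofHom (π : E →⋆ₙₐ[ℂ] D) : CStarSeminorm E where
  toFun x := ‖π x‖
  map_zero' := by simp
  add_le' x y := by simpa using norm_add_le (π x) (π y)
  neg' x := by
    have : π (-x) = - π x := map_neg (π : E →ₗ[ℂ] D) x
    rw [this, norm_neg]
  smul' c x := by simp [norm_smul]
  mul_le' x y := by simpa using norm_mul_le (π x) (π y)
  star_mul_self' x := by
    rw [map_mul, StarHomClass.map_star, CStarRing.norm_star_mul_self, sq]

end Completion

/-! ### The maximal tensor product of C⋆-algebras -/

section MaxTensor

variable {A B D : Type u} [NonUnitalCStarAlgebra A] [NonUnitalCStarAlgebra B]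
  [NonUnitalCStarAlgebra D]

theorem exists_bound_left (γ : CStarSeminorm (A ⊗[ℂ] B)) (b : B) :
    ∃ C : ℝ, ∀ a : A, γ (a ⊗ₜ b) ≤ C * ‖a‖ := by
  let _ := CStarAlgebra.spectralOrder A
  have _ := CStarAlgebra.spectralOrderedRing A
  let _ := CStarAlgebra.spectralOrder γ.Completion
  have _ := CStarAlgebra.spectralOrderedRing γ.Completion
  let f : A →ₗ[ℂ] γ.Completion :=
    γ.coeL ∘ₗ (TensorProduct.mk ℂ A B).flip (star b * b)
  have hf : ∀ a, ‖f a‖ = γ (a ⊗ₜ (star b * b)) := fun a => γ.norm_coeL _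
  have hpos : ∀ a, 0 ≤ a → 0 ≤ f a := by
    intro a ha
    obtain ⟨c, rfl⟩ := CStarAlgebra.nonneg_iff_eq_star_mul_self.mp ha
    have : f (star c * c) = star (γ.coeL (c ⊗ₜ b)) * γ.coeL (c ⊗ₜ b) := by
      rw [← γ.coeL_star, ← γ.coeL_mul, TensorProduct.star_tmul,
        Algebra.TensorProduct.tmul_mul_tmul]
      rfl
    rw [this]
    exact star_mul_self_nonneg _
  obtain ⟨C, hC⟩ := PositiveLinearMap.exists_norm_apply_le (PositiveLinearMap.mk₀ f hpos)
  refine ⟨Real.sqrt C, fun a => ?_⟩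
  have h1 : γ (a ⊗ₜ b) ^ 2 ≤ C * (‖a‖ * ‖a‖) := by
    rw [← γ.star_mul_self, TensorProduct.star_tmul, Algebra.TensorProduct.tmul_mul_tmul, ← hf,
      ← CStarRing.norm_star_mul_self]
    exact hC _
  refine abs_le_of_sq_le_sq' ?_ (by positivity) |>.2
  rw [mul_pow, Real.sq_sqrt C.coe_nonneg, sq ‖a‖]
  exact h1

theorem exists_bound_right (γ : CStarSeminorm (A ⊗[ℂ] B)) (a : A) :
    ∃ C : ℝ, ∀ b : B, γ (a ⊗ₜ b) ≤ C * ‖b‖ := by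
  let _ := CStarAlgebra.spectralOrder B
  have _ := CStarAlgebra.spectralOrderedRing B
  let _ := CStarAlgebra.spectralOrder γ.Completion
  have _ := CStarAlgebra.spectralOrderedRing γ.Completion
  let f : B →ₗ[ℂ] γ.Completion :=
    γ.coeL ∘ₗ (TensorProduct.mk ℂ A B) (star a * a)
  have hf : ∀ b, ‖f b‖ = γ ((star a * a) ⊗ₜ b) := fun b => γ.norm_coeL _
  have hpos : ∀ b, 0 ≤ b → 0 ≤ f b := by
    intro b hb
    obtain ⟨c, rfl⟩ := CStarAlgebra.nonneg_iff_eq_star_mul_self.mp hb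
    have : f (star c * c) = star (γ.coeL (a ⊗ₜ c)) * γ.coeL (a ⊗ₜ c) := by
      rw [← γ.coeL_star, ← γ.coeL_mul, TensorProduct.star_tmul,
        Algebra.TensorProduct.tmul_mul_tmul]
      rfl
    rw [this]
    exact star_mul_self_nonneg _
  obtain ⟨C, hC⟩ := PositiveLinearMap.exists_norm_apply_le (PositiveLinearMap.mk₀ f hpos)
  refine ⟨Real.sqrt C, fun b => ?_⟩
  have h1 : γ (a ⊗ₜ b) ^ 2 ≤ C * (‖b‖ * ‖b‖) := by
    rw [← γ.star_mul_self, TensorProduct.star_tmul, Algebra.TensorProduct.tmul_mul_tmul, ← hf,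
      ← CStarRing.norm_star_mul_self]
    exact hC _
  refine abs_le_of_sq_le_sq' ?_ (by positivity) |>.2
  rw [mul_pow, Real.sq_sqrt C.coe_nonneg, sq ‖b‖]
  exact h1

theorem exists_bound (γ : CStarSeminorm (A ⊗[ℂ] B)) :
    ∃ K : ℝ, ∀ (a : A) (b : B), γ (a ⊗ₜ b) ≤ K * (‖a‖ * ‖b‖) := by
  choose R hR using exists_bound_right γ
  choose M hM using exists_bound_left γ
  let T : A → (B →L[ℂ] γ.Completion) := fun a =>
    (γ.coeL ∘ₗ (TensorProduct.mk ℂ A B) a).mkContinuous (R a)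
      fun b => by simpa [γ.norm_coeL] using hR a b
  have hT : ∀ a b, ‖T a b‖ = γ (a ⊗ₜ b) := fun a b => γ.norm_coeL _
  obtain ⟨K, hK⟩ := banach_steinhaus (g := fun a : Metric.closedBall (0 : A) 1 => T a)
    (fun b => ⟨|M b|, fun a => by
      rw [hT]
      have ha : ‖(a : A)‖ ≤ 1 := mem_closedBall_zero_iff.mp a.2
      calc γ ((a : A) ⊗ₜ b) ≤ M b * ‖(a : A)‖ := hM b a
        _ ≤ |M b| * ‖(a : A)‖ := by gcongr; exact le_abs_self _
        _ ≤ |M b| * 1 := by gcongr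
        _ = |M b| := mul_one _⟩)
  refine ⟨K, fun a b => ?_⟩
  by_cases ha : a = 0
  · subst ha
    simp
  have ha' : (0 : ℝ) < ‖a‖ := norm_pos_iff.mpr ha
  let c : ℂ := ((‖a‖⁻¹ : ℝ) : ℂ)
  have hc : ‖c‖ = ‖a‖⁻¹ := by simp [c]
  have hca : c • a ∈ Metric.closedBall (0 : A) 1 := by
    simp [norm_smul, hc, ha'.ne']
  have h1 := (T (c • a)).le_of_opNorm_le (hK ⟨c • a, hca⟩) b
  rw [hT, ← TensorProduct.smul_tmul', map_smul_eq_mul, hc] at h1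
  rw [inv_mul_le_iff₀ ha'] at h1
  linarith

theorem tmul_le (γ : CStarSeminorm (A ⊗[ℂ] B)) (a : A) (b : B) :
    γ (a ⊗ₜ b) ≤ ‖a‖ * ‖b‖ := by
  obtain ⟨K, hK⟩ := exists_bound γ
  have key : ∀ (n : ℕ) (a : A) (b : B),
      γ (a ⊗ₜ b) ^ (2 ^ n) ≤ K * (‖a‖ * ‖b‖) ^ (2 ^ n) := by
    intro n
    induction n with
    | zero => intro a b; simpa using hK a b
    | succ n ih =>
      intro a b
      have h := ih (star a * a) (star b * b)
      rw [← Algebra.TensorProduct.tmul_mul_tmul, ← TensorProduct.star_tmul, γ.star_mul_self,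
        CStarRing.norm_star_mul_self, CStarRing.norm_star_mul_self, ← pow_mul] at h
      rw [pow_succ' 2 n, pow_mul (‖a‖ * ‖b‖)]
      convert h using 3
      ring
  by_contra! hlt
  have hg : 0 < γ (a ⊗ₜ b) := lt_of_le_of_lt (by positivity) hlt
  rcases (show (0 : ℝ) ≤ ‖a‖ * ‖b‖ by positivity).eq_or_lt with h0 | h0
  · have := hK a b
    rw [← h0, mul_zero] at this
    linarith
  · have hr : 1 < γ (a ⊗ₜ b) / (‖a‖ * ‖b‖) := by rwa [one_lt_div h0]
    obtain ⟨n, hn⟩ := pow_unbounded_of_one_lt K hr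
    have h1 := key n a b
    rw [← div_le_iff₀ (by positivity), ← div_pow] at h1
    have h2 : (γ (a ⊗ₜ b) / (‖a‖ * ‖b‖)) ^ n ≤ (γ (a ⊗ₜ b) / (‖a‖ * ‖b‖)) ^ (2 ^ n) :=
      pow_le_pow_right₀ hr.le n.lt_two_pow_self.le
    linarith

theorem exists_bound_all (x : A ⊗[ℂ] B) : ∃ C : ℝ, ∀ γ : CStarSeminorm (A ⊗[ℂ] B), γ x ≤ C := by
  induction x with
  | zero => exact ⟨0, fun γ => by simp⟩
  | tmul a b => exact ⟨‖a‖ * ‖b‖, fun γ => tmul_le γ a b⟩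
  | add x y hx hy =>
    obtain ⟨C, hC⟩ := hx
    obtain ⟨C', hC'⟩ := hy
    exact ⟨C + C', fun γ => (map_add_le_add γ.toSeminorm x y).trans (add_le_add (hC γ) (hC' γ))⟩

theorem bddAbove_range (x : A ⊗[ℂ] B) :
    BddAbove (Set.range fun γ : CStarSeminorm (A ⊗[ℂ] B) => γ x) := by
  obtain ⟨C, hC⟩ := exists_bound_all x
  exact ⟨C, by rintro _ ⟨γ, rfl⟩; exact hC γ⟩

instance : Nonempty (CStarSeminorm (A ⊗[ℂ] B)) :=
  ⟨{ toSeminorm := 0, mul_le' := fun _ _ => (mul_zero (0 : ℝ)).ge,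
     star_mul_self' := fun _ => (zero_pow (M₀ := ℝ) two_ne_zero).symm }⟩

variable (A B) in
/-- The maximal C⋆-norm on the algebraic tensor product: the supremum of all C⋆-seminorms. -/
def maxCStarSeminorm : CStarSeminorm (A ⊗[ℂ] B) where
  toFun x := ⨆ γ : CStarSeminorm (A ⊗[ℂ] B), γ x
  map_zero' := by simp
  add_le' x y := ciSup_le fun γ => (map_add_le_add γ.toSeminorm x y).trans
    (add_le_add (le_ciSup (bddAbove_range x) γ) (le_ciSup (bddAbove_range y) γ))
  neg' x := by simp
  smul' c x := by simp [map_smul_eq_mul, Real.mul_iSup_of_nonneg]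
  mul_le' x y := ciSup_le fun γ => (γ.mul_le x y).trans
    (mul_le_mul (le_ciSup (bddAbove_range x) γ) (le_ciSup (bddAbove_range y) γ)
      (apply_nonneg _ _) (Real.iSup_nonneg fun γ => apply_nonneg _ _))
  star_mul_self' x := by
    apply le_antisymm
    · refine ciSup_le fun γ => ?_
      rw [γ.star_mul_self]
      exact pow_le_pow_left₀ (apply_nonneg _ _) (le_ciSup (bddAbove_range x) γ) 2
    · rw [Real.iSup_pow (fun γ => apply_nonneg _ _)]
      refine ciSup_le fun γ => ?_
      rw [← γ.star_mul_self]
      exact le_ciSup (bddAbove_range (star x * x)) γ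

theorem le_max (γ : CStarSeminorm (A ⊗[ℂ] B)) (x : A ⊗[ℂ] B) : γ x ≤ maxCStarSeminorm A B x :=
  le_ciSup (bddAbove_range x) γ

end MaxTensor

end CStarSeminorm

section MaxTensor

open CStarSeminorm

variable {A B D : Type u} [NonUnitalCStarAlgebra A] [NonUnitalCStarAlgebra B]
  [NonUnitalCStarAlgebra D]

variable (A B) in
/-- The maximal tensor product of two C⋆-algebras. -/
def MaxTensor : Type u := (maxCStarSeminorm A B).Completion

noncomputable instance : NonUnitalCStarAlgebra (MaxTensor A B) :=
  inferInstanceAs (NonUnitalCStarAlgebra (maxCStarSeminorm A B).Completion)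

namespace MaxTensor

variable (A B) in
/-- The canonical ⋆-homomorphism from the algebraic tensor product to the maximal one. -/
def coe : A ⊗[ℂ] B →⋆ₙₐ[ℂ] MaxTensor A B := (maxCStarSeminorm A B).coe

theorem norm_coe (x : A ⊗[ℂ] B) : ‖coe A B x‖ = maxCStarSeminorm A B x :=
  (maxCStarSeminorm A B).norm_coeL x

@[elab_as_elim]
theorem induction {P : MaxTensor A B → Prop} (x : MaxTensor A B) (hc : IsClosed {x | P x})
    (h : ∀ x, P (coe A B x)) : P x :=
  (maxCStarSeminorm A B).induction x hc h

@[elab_as_elim]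
theorem induction₂ {P : MaxTensor A B → MaxTensor A B → Prop} (x y : MaxTensor A B)
    (hc : IsClosed {z : MaxTensor A B × MaxTensor A B | P z.1 z.2})
    (h : ∀ x y, P (coe A B x) (coe A B y)) : P x y :=
  (maxCStarSeminorm A B).induction₂ x y hc h

/-- Elementary tensors in the maximal tensor product, as a bilinear map. -/
def tmul : A →ₗ[ℂ] B →ₗ[ℂ] MaxTensor A B :=
  (TensorProduct.mk ℂ A B).compr₂ (coe A B : A ⊗[ℂ] B →ₗ[ℂ] MaxTensor A B)

theorem coe_tmul (a : A) (b : B) : coe A B (a ⊗ₜ b) = tmul a b := rfl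

theorem tmul_mul (a a' : A) (b b' : B) :
    tmul a b * tmul a' b' = tmul (a * a') (b * b') := by
  simp only [← coe_tmul, ← map_mul, Algebra.TensorProduct.tmul_mul_tmul]

theorem star_tmul (a : A) (b : B) : star (tmul a b) = tmul (star a) (star b) := by
  simp only [← coe_tmul, ← StarHomClass.map_star, TensorProduct.star_tmul]

theorem norm_tmul_le (a : A) (b : B) : ‖tmul a b‖ ≤ ‖a‖ * ‖b‖ := by
  rw [← coe_tmul, norm_coe]
  exact tmul_le _ a b

theorem hom_ext {f g : MaxTensor A B →⋆ₙₐ[ℂ] D} (h : ∀ a b, f (tmul a b) = g (tmul a b)) :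
    f = g := by
  refine (maxCStarSeminorm A B).hom_ext (D := D) (f := f) (g := g) fun x => ?_
  change f (coe A B x) = g (coe A B x)
  induction x with
  | zero => simp
  | tmul a b => exact h a b
  | add x y hx hy => simp only [map_add, hx, hy]

/-- A bilinear map that is multiplicative and ⋆-preserving on elementary tensors induces a
⋆-homomorphism on the algebraic tensor product. -/
def algLift (f : A →ₗ[ℂ] B →ₗ[ℂ] D) (hm : ∀ a a' b b', f (a * a') (b * b') = f a b * f a' b')
    (hs : ∀ a b, f (star a) (star b) = star (f a b)) : A ⊗[ℂ] B →⋆ₙₐ[ℂ] D where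
  toFun := TensorProduct.lift f
  map_smul' := map_smul _
  map_zero' := map_zero _
  map_add' := map_add _
  map_mul' x y := by
    induction x with
    | zero => simp
    | add x x' hx hx' => simp only [add_mul, map_add, hx, hx']
    | tmul a b =>
      induction y with
      | zero => simp
      | add y y' hy hy' => simp only [mul_add, map_add, hy, hy']
      | tmul a' b' => simp [hm]
  map_star' x := by
    induction x with
    | zero => simp
    | add x x' hx hx' => simp only [star_add, map_add, hx, hx']
    | tmul a b => simp [hs]

/-- The universal property of the maximal tensor product with respect to bilinear maps that are
multiplicative and ⋆-preserving on elementary tensors. -/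
def lift (f : A →ₗ[ℂ] B →ₗ[ℂ] D) (hm : ∀ a a' b b', f (a * a') (b * b') = f a b * f a' b')
    (hs : ∀ a b, f (star a) (star b) = star (f a b)) : MaxTensor A B →⋆ₙₐ[ℂ] D :=
  (maxCStarSeminorm A B).lift (algLift f hm hs)
    fun x => le_max (CStarSeminorm.ofHom (algLift f hm hs)) x

theorem lift_tmul (f : A →ₗ[ℂ] B →ₗ[ℂ] D)
    (hm : ∀ a a' b b', f (a * a') (b * b') = f a b * f a' b')
    (hs : ∀ a b, f (star a) (star b) = star (f a b)) (a : A) (b : B) :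
    lift f hm hs (tmul a b) = f a b :=
  ((maxCStarSeminorm A B).lift_coe _ _ (a ⊗ₜ b)).trans (TensorProduct.lift.tmul a b)

/-- The tensor product of two ⋆-homomorphisms. -/
def map {A' B' : Type u} [NonUnitalCStarAlgebra A'] [NonUnitalCStarAlgebra B']
    (f : A →⋆ₙₐ[ℂ] A') (g : B →⋆ₙₐ[ℂ] B') : MaxTensor A B →⋆ₙₐ[ℂ] MaxTensor A' B' :=
  lift (tmul.compl₁₂ (f : A →ₗ[ℂ] A') (g : B →ₗ[ℂ] B'))
    (fun a a' b b' => by simp [tmul_mul]) (fun a b => by simp [star_tmul, StarHomClass.map_star])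

theorem map_tmul {A' B' : Type u} [NonUnitalCStarAlgebra A'] [NonUnitalCStarAlgebra B']
    (f : A →⋆ₙₐ[ℂ] A') (g : B →⋆ₙₐ[ℂ] B') (a : A) (b : B) :
    map f g (tmul a b) = tmul (f a) (g b) :=
  lift_tmul _ _ _ a b

theorem map_id : map (NonUnitalStarAlgHom.id ℂ A) (NonUnitalStarAlgHom.id ℂ B) =
    NonUnitalStarAlgHom.id ℂ (MaxTensor A B) :=
  hom_ext fun a b => map_tmul _ _ a b

theorem map_comp {A' B' A'' B'' : Type u} [NonUnitalCStarAlgebra A'] [NonUnitalCStarAlgebra B']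
    [NonUnitalCStarAlgebra A''] [NonUnitalCStarAlgebra B'']
    (f' : A' →⋆ₙₐ[ℂ] A'') (g' : B' →⋆ₙₐ[ℂ] B'') (f : A →⋆ₙₐ[ℂ] A') (g : B →⋆ₙₐ[ℂ] B') :
    (map f' g').comp (map f g) = map (f'.comp f) (g'.comp g) :=
  hom_ext fun a b => by
    simp only [NonUnitalStarAlgHom.comp_apply, map_tmul]

end MaxTensor

namespace MaxTensor

section Assoc

variable {A B C : Type u} [NonUnitalCStarAlgebra A] [NonUnitalCStarAlgebra B]
  [NonUnitalCStarAlgebra C]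

variable (A B C) in
/-- The trilinear map `a, b ⊗ c ↦ (a ⊗ b) ⊗ c`. -/
def assocAux : A →ₗ[ℂ] (B ⊗[ℂ] C) →ₗ[ℂ] MaxTensor (MaxTensor A B) C :=
  (TensorProduct.lift.equiv (.id ℂ) B C (MaxTensor (MaxTensor A B) C)).toLinearMap ∘ₗ
    (tmul (A := A) (B := B)).compr₂ (tmul (A := MaxTensor A B) (B := C))

theorem assocAux_tmul (a : A) (b : B) (c : C) :
    assocAux A B C a (b ⊗ₜ c) = tmul (tmul a b) c := rfl

theorem assocAux_mul (a a' : A) (x y : B ⊗[ℂ] C) :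
    assocAux A B C (a * a') (x * y) = assocAux A B C a x * assocAux A B C a' y := by
  induction x with
  | zero => simp
  | add x x' hx hx' => simp only [add_mul, map_add, hx, hx']
  | tmul b c =>
    induction y with
    | zero => simp
    | add y y' hy hy' => simp only [mul_add, map_add, hy, hy']
    | tmul b' c' => simp only [Algebra.TensorProduct.tmul_mul_tmul, assocAux_tmul, tmul_mul]

theorem assocAux_star (a : A) (x : B ⊗[ℂ] C) :
    assocAux A B C (star a) (star x) = star (assocAux A B C a x) := by
  induction x with
  | zero => simp
  | add x x' hx hx' => simp only [star_add, map_add, hx, hx']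
  | tmul b c => simp only [TensorProduct.star_tmul, assocAux_tmul, star_tmul]

theorem exists_assocAux_bound (x : B ⊗[ℂ] C) :
    ∃ K : ℝ, 0 ≤ K ∧ ∀ a : A, ‖assocAux A B C a x‖ ≤ K * ‖a‖ := by
  induction x with
  | zero => exact ⟨0, le_rfl, fun a => by simp⟩
  | add x y hx hy =>
    obtain ⟨K, h0, hK⟩ := hx
    obtain ⟨K', h0', hK'⟩ := hy
    refine ⟨K + K', by positivity, fun a => ?_⟩
    rw [map_add, add_mul]
    exact (norm_add_le _ _).trans (add_le_add (hK a) (hK' a))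
  | tmul b c =>
    refine ⟨‖b‖ * ‖c‖, by positivity, fun a => ?_⟩
    rw [assocAux_tmul]
    calc _ ≤ ‖tmul a b‖ * ‖c‖ := norm_tmul_le _ _
      _ ≤ (‖a‖ * ‖b‖) * ‖c‖ := by gcongr; exact norm_tmul_le _ _
      _ = ‖b‖ * ‖c‖ * ‖a‖ := by ring

theorem continuous_assocAux (x : B ⊗[ℂ] C) : Continuous fun a : A => assocAux A B C a x := by
  obtain ⟨K, -, hK⟩ := exists_assocAux_bound (A := A) x
  exact (((assocAux A B C).flip x).mkContinuous K hK).continuous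

theorem assocAux_bdd (x : B ⊗[ℂ] C) : BddAbove
    (Set.range fun a : Metric.closedBall (0 : A) 1 => ‖assocAux A B C (a : A) x‖) := by
  obtain ⟨K, h0, hK⟩ := exists_assocAux_bound (A := A) x
  refine ⟨K, ?_⟩
  rintro _ ⟨a, rfl⟩
  exact (hK a).trans (mul_le_of_le_one_right h0 (mem_closedBall_zero_iff.mp a.2))

instance : Nonempty (Metric.closedBall (0 : A) 1) := ⟨⟨0, by simp⟩⟩

theorem assocAux_le_iSup (x : B ⊗[ℂ] C) (a : A) (ha : ‖a‖ ≤ 1) :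
    ‖assocAux A B C a x‖ ≤ ⨆ a : Metric.closedBall (0 : A) 1, ‖assocAux A B C (a : A) x‖ :=
  le_ciSup (assocAux_bdd x) ⟨a, mem_closedBall_zero_iff.mpr ha⟩

theorem assocAux_iSup_le (x : B ⊗[ℂ] C) (K : ℝ)
    (h : ∀ a : A, ‖a‖ ≤ 1 → ‖assocAux A B C a x‖ ≤ K) :
    (⨆ a : Metric.closedBall (0 : A) 1, ‖assocAux A B C (a : A) x‖) ≤ K :=
  ciSup_le fun a => h a (mem_closedBall_zero_iff.mp a.2)

theorem assocAux_iSup_mul_le (x y : B ⊗[ℂ] C) :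
    (⨆ a : Metric.closedBall (0 : A) 1, ‖assocAux A B C (a : A) (x * y)‖) ≤
    (⨆ a : Metric.closedBall (0 : A) 1, ‖assocAux A B C (a : A) x‖) *
      (⨆ a : Metric.closedBall (0 : A) 1, ‖assocAux A B C (a : A) y‖) := by
  let _ := CStarAlgebra.spectralOrder A
  have _ := CStarAlgebra.spectralOrderedRing A
  refine assocAux_iSup_le _ _ fun a ha => ?_
  have hl := CStarAlgebra.increasingApproximateUnit A
  have ht : Filter.Tendsto (fun e : A => ‖assocAux A B C (e * a) (x * y)‖)
      (CStarAlgebra.approximateUnit A) (nhds ‖assocAux A B C a (x * y)‖) :=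
    ((continuous_assocAux (x * y)).norm.tendsto a).comp (hl.tendsto_mul_right a)
  refine le_of_tendsto ht (hl.eventually_norm.mono fun e he => ?_)
  rw [assocAux_mul]
  exact (norm_mul_le _ _).trans (mul_le_mul (assocAux_le_iSup x e he) (assocAux_le_iSup y a ha)
    (norm_nonneg _) (Real.iSup_nonneg fun _ => norm_nonneg _))

variable (A B C) in
/-- The C⋆-seminorm `x ↦ sup {‖a ⊗ x‖ : ‖a‖ ≤ 1}` on the algebraic tensor product of `B` and
`C`. -/
def assocSeminorm : CStarSeminorm (B ⊗[ℂ] C) where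
  toFun x := ⨆ a : Metric.closedBall (0 : A) 1, ‖assocAux A B C (a : A) x‖
  map_zero' := by simp
  add_le' x y := assocAux_iSup_le _ _ fun a ha => by
    rw [map_add]
    exact (norm_add_le _ _).trans (add_le_add (assocAux_le_iSup x a ha) (assocAux_le_iSup y a ha))
  neg' x := by simp
  smul' c x := by simp [norm_smul, Real.mul_iSup_of_nonneg]
  mul_le' := assocAux_iSup_mul_le
  star_mul_self' x := by
    apply le_antisymm
    · refine (assocAux_iSup_mul_le (star x) x).trans ?_
      rw [sq]
      refine mul_le_mul_of_nonneg_right ?_ (Real.iSup_nonneg fun _ => norm_nonneg _)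
      refine assocAux_iSup_le _ _ fun a ha => ?_
      have := assocAux_star (star a) x
      rw [star_star] at this
      rw [this, norm_star]
      exact assocAux_le_iSup x (star a) (by rwa [norm_star])
    · change (⨆ a : Metric.closedBall (0 : A) 1, ‖assocAux A B C (a : A) x‖) ^ 2 ≤ _
      rw [Real.iSup_pow (fun _ => norm_nonneg _)]
      refine ciSup_le fun a => ?_
      rw [sq, ← CStarRing.norm_star_mul_self, ← assocAux_star, ← assocAux_mul]
      refine assocAux_le_iSup (star x * x) _ ?_
      have ha : ‖(a : A)‖ ≤ 1 := mem_closedBall_zero_iff.mp a.2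
      rw [CStarRing.norm_star_mul_self]
      exact mul_le_one₀ ha (norm_nonneg _) ha

theorem norm_assocAux_le (a : A) (x : B ⊗[ℂ] C) :
    ‖assocAux A B C a x‖ ≤ ‖a‖ * maxCStarSeminorm B C x := by
  by_cases ha : a = 0
  · simp [ha]
  have ha' : (0 : ℝ) < ‖a‖ := norm_pos_iff.mpr ha
  have h1 := (assocAux_le_iSup x ((((‖a‖⁻¹ : ℝ) : ℂ)) • a)
    (by simp [norm_smul, ha'.ne'])).trans (CStarSeminorm.le_max (assocSeminorm A B C) x)
  rw [map_smul, LinearMap.smul_apply, norm_smul, Complex.norm_real, norm_inv, norm_norm,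
    inv_mul_le_iff₀ ha'] at h1
  exact h1

/-- For fixed `a : A`, the bounded extension of `b ⊗ c ↦ (a ⊗ b) ⊗ c`. -/
def assocExt (a : A) : MaxTensor B C →L[ℂ] MaxTensor (MaxTensor A B) C :=
  (maxCStarSeminorm B C).extendL (D := MaxTensor (MaxTensor A B) C) (assocAux A B C a)

theorem assocExt_coe (a : A) (x : B ⊗[ℂ] C) :
    assocExt a (coe B C x) = assocAux A B C a x :=
  (maxCStarSeminorm B C).extendL_coeL (D := MaxTensor (MaxTensor A B) C) _ ⟨‖a‖, norm_assocAux_le a⟩ x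

variable (A B C) in
/-- The bilinear map `(a, x) ↦ assocExt a x`. -/
def assocBilin : A →ₗ[ℂ] MaxTensor B C →ₗ[ℂ] MaxTensor (MaxTensor A B) C where
  toFun a := (assocExt a).toLinearMap
  map_add' a a' := by
    ext x
    exact induction x
      (isClosed_eq (assocExt (a + a')).continuous
        ((assocExt a).continuous.add (assocExt a').continuous))
      fun x => by
        change assocExt (a + a') _ = assocExt a _ + assocExt a' _
        simp only [assocExt_coe, map_add, LinearMap.add_apply]
  map_smul' c a := by
    ext x
    exact induction x
      (isClosed_eq (assocExt (c • a)).continuous ((assocExt a).continuous.const_smul c))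
      fun x => by
        change assocExt (c • a) _ = c • assocExt a _
        simp only [assocExt_coe, map_smul, LinearMap.smul_apply]

variable (A B C) in
/-- The inverse associator `a ⊗ (b ⊗ c) ↦ (a ⊗ b) ⊗ c` of the maximal tensor product. -/
def assocInv : MaxTensor A (MaxTensor B C) →⋆ₙₐ[ℂ] MaxTensor (MaxTensor A B) C :=
  lift (assocBilin A B C)
    (fun a a' x y => induction₂ x y
      (isClosed_eq ((assocExt (a * a')).continuous.comp continuous_mul)
        (((assocExt a).continuous.comp continuous_fst).mul
          ((assocExt a').continuous.comp continuous_snd)))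
      fun x y => by
        change assocExt (a * a') _ = assocExt a _ * assocExt a' _
        rw [← map_mul, assocExt_coe, assocExt_coe, assocExt_coe, assocAux_mul])
    (fun a x => induction x
      (isClosed_eq ((assocExt (star a)).continuous.comp continuous_star)
        (continuous_star.comp (assocExt a).continuous))
      fun x => by
        change assocExt (star a) _ = star (assocExt a _)
        rw [← StarHomClass.map_star, assocExt_coe, assocExt_coe, assocAux_star])

theorem assocInv_tmul (a : A) (b : B) (c : C) :
    assocInv A B C (tmul a (tmul b c)) = tmul (tmul a b) c := by
  rw [assocInv, lift_tmul]
  exact assocExt_coe a (b ⊗ₜ c)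

theorem hom_ext₃ {D : Type u} [NonUnitalCStarAlgebra D]
    {f g : MaxTensor A (MaxTensor B C) →⋆ₙₐ[ℂ] D}
    (h : ∀ a b c, f (tmul a (tmul b c)) = g (tmul a (tmul b c))) : f = g := by
  refine hom_ext fun a x => ?_
  have hc : Continuous fun x : MaxTensor B C => tmul a x :=
    (LinearMap.mkContinuous (tmul a) ‖a‖ fun x => norm_tmul_le a x).continuous
  refine induction x
    (isClosed_eq ((continuous_hom f).comp hc) ((continuous_hom g).comp hc)) fun x => ?_
  induction x with
  | zero => simp
  | tmul b c => exact h a b c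
  | add x y hx hy => simp only [map_add, hx, hy]

theorem assocInv_naturality {A' B' C' : Type u} [NonUnitalCStarAlgebra A']
    [NonUnitalCStarAlgebra B'] [NonUnitalCStarAlgebra C']
    (f : A →⋆ₙₐ[ℂ] A') (g : B →⋆ₙₐ[ℂ] B') (h : C →⋆ₙₐ[ℂ] C') :
    (assocInv A' B' C').comp (map f (map g h)) = (map (map f g) h).comp (assocInv A B C) :=
  hom_ext₃ fun a b c => by
    simp only [NonUnitalStarAlgHom.comp_apply, map_tmul, assocInv_tmul]

end Assoc

end MaxTensor

end MaxTensor

/-! ### The category of C⋆-algebras and the tensoring endofunctors -/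

/-- The one-dimensional C⋆-algebra `ℂ`, placed in the universe `u`. -/
instance : NonUnitalCStarAlgebra (ULift.{u} ℂ) where
  star z := ⟨star z.down⟩
  star_involutive z := ULift.ext _ _ (star_star z.down)
  star_mul z w := ULift.ext _ _ (star_mul z.down w.down)
  star_add z w := ULift.ext _ _ (star_add z.down w.down)
  norm_mul_self_le z := (CStarRing.norm_star_mul_self (x := z.down)).ge
  star_smul c z := ULift.ext _ _ (star_smul c z.down)
  smul_assoc c z w := smul_mul_assoc c z w
  smul_comm c z w := (mul_smul_comm c z w).symm

namespace MaxTensor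

/-- The ⋆-homomorphism `B → ℂ ⊗ B`, `b ↦ 1 ⊗ b`. -/
def unitHom (B : Type u) [NonUnitalCStarAlgebra B] : B →⋆ₙₐ[ℂ] MaxTensor (ULift.{u} ℂ) B where
  toFun b := tmul (1 : ULift.{u} ℂ) b
  map_smul' c b := map_smul (tmul (1 : ULift.{u} ℂ)) c b
  map_zero' := map_zero (tmul (1 : ULift.{u} ℂ))
  map_add' b b' := map_add (tmul (1 : ULift.{u} ℂ)) b b'
  map_mul' b b' := by rw [tmul_mul, one_mul]
  map_star' b := by
    rw [star_tmul]
    exact congrArg (fun z : ULift.{u} ℂ => tmul z (star b)) (ULift.ext _ _ (star_one ℂ).symm)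

theorem unitHom_naturality {B B' : Type u} [NonUnitalCStarAlgebra B] [NonUnitalCStarAlgebra B']
    (g : B →⋆ₙₐ[ℂ] B') :
    (unitHom B').comp g =
      (map (NonUnitalStarAlgHom.id ℂ (ULift.{u} ℂ)) g).comp (unitHom B) :=
  NonUnitalStarAlgHom.ext fun b =>
    (map_tmul (NonUnitalStarAlgHom.id ℂ (ULift.{u} ℂ)) g 1 b).symm

end MaxTensor

/-- The type of (complex, not necessarily unital) C⋆-algebras. -/
structure CStarCat : Type (u + 1) where
  carrier : Type u
  [str : NonUnitalCStarAlgebra carrier]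

attribute [instance] CStarCat.str

namespace CStarCat

/-- Morphisms of C⋆-algebras are ⋆-homomorphisms. -/
@[ext]
structure Hom (A B : CStarCat.{u}) : Type u where
  hom : A.carrier →⋆ₙₐ[ℂ] B.carrier

/-- The category of C⋆-algebras and ⋆-homomorphisms. -/
instance : Category.{u} CStarCat.{u} where
  Hom := Hom
  id A := ⟨NonUnitalStarAlgHom.id ℂ A.carrier⟩
  comp f g := ⟨g.hom.comp f.hom⟩

/-- The maximal tensor product `A ⊗ B`. -/
def tensor (A B : CStarCat.{u}) : CStarCat.{u} := ⟨MaxTensor A.carrier B.carrier⟩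

/-- The tensor product `f ⊗ g` of two ⋆-homomorphisms. -/
def tensorHom {A A' B B' : CStarCat.{u}} (f : A ⟶ A') (g : B ⟶ B') :
    tensor A B ⟶ tensor A' B' := ⟨MaxTensor.map f.hom g.hom⟩

theorem tensorHom_id (A B : CStarCat.{u}) : tensorHom (𝟙 A) (𝟙 B) = 𝟙 (tensor A B) :=
  Hom.ext MaxTensor.map_id

theorem tensorHom_comp {A A' A'' B B' B'' : CStarCat.{u}} (f : A ⟶ A') (f' : A' ⟶ A'')
    (g : B ⟶ B') (g' : B' ⟶ B'') :
    tensorHom (f ≫ f') (g ≫ g') = tensorHom f g ≫ tensorHom f' g' :=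
  Hom.ext (MaxTensor.map_comp f'.hom g'.hom f.hom g.hom).symm

/-- The unit object `ℂ`. -/
def unit : CStarCat.{u} := ⟨ULift.{u} ℂ⟩

/-- The inverse left unitor `B → ℂ ⊗ B`, `b ↦ 1 ⊗ b`. -/
def leftUnitorInv (B : CStarCat.{u}) : B ⟶ tensor unit B := ⟨MaxTensor.unitHom B.carrier⟩

/-- The inverse associator `A ⊗ (B ⊗ C) → (A ⊗ B) ⊗ C`, `a ⊗ (b ⊗ c) ↦ (a ⊗ b) ⊗ c`. -/
def associatorInv (A B C : CStarCat.{u}) : tensor A (tensor B C) ⟶ tensor (tensor A B) C :=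
  ⟨MaxTensor.assocInv A.carrier B.carrier C.carrier⟩

/-- The endofunctor `𝔇_A = A ⊗ _`. -/
def tensoring (A : CStarCat.{u}) : CStarCat.{u} ⥤ CStarCat.{u} where
  obj B := tensor A B
  map g := tensorHom (𝟙 A) g
  map_id B := tensorHom_id A B
  map_comp g h := by rw [← tensorHom_comp, Category.id_comp]

/-- The natural transformation `𝔇_φ : 𝔇_A ⟶ 𝔇_{A'}` with components `φ ⊗ B`. -/
def tensoringMap {A A' : CStarCat.{u}} (φ : A ⟶ A') : tensoring A ⟶ tensoring A' where
  app B := tensorHom φ (𝟙 B)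
  naturality _ _ g := by
    change tensorHom _ _ ≫ tensorHom _ _ = tensorHom _ _ ≫ tensorHom _ _
    rw [← tensorHom_comp, ← tensorHom_comp, Category.id_comp, Category.id_comp,
      Category.comp_id, Category.comp_id]

/-- The natural transformation `𝔇² : 𝔇_A 𝔇_{A'} ⟶ 𝔇_{A ⊗ A'}` with components
`A ⊗ (A' ⊗ B) → (A ⊗ A') ⊗ B`. -/
def tensoringMul (A A' : CStarCat.{u}) :
    tensoring A' ⋙ tensoring A ⟶ tensoring (tensor A A') where
  app B := associatorInv A A' B
  naturality B B' g := by
    change tensorHom (𝟙 A) (tensorHom (𝟙 A') g) ≫ associatorInv A A' B' =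
      associatorInv A A' B ≫ tensorHom (𝟙 (tensor A A')) g
    rw [← tensorHom_id A A']
    exact Hom.ext (MaxTensor.assocInv_naturality _ _ g.hom)

/-- The natural transformation `𝔇⁰ : Id ⟶ 𝔇_ℂ` with components `B → ℂ ⊗ B`. -/
def tensoringUnit : 𝟭 CStarCat.{u} ⟶ tensoring unit where
  app B := leftUnitorInv B
  naturality _ _ g := Hom.ext (MaxTensor.unitHom_naturality g.hom)

end CStarCat

open CStarCat

/-! ### Labeled endofunctors -/

/-- The axioms of a labeling `κ^A : 𝔇_A F ⟶ F 𝔇_A` of an endofunctor `F` of the category of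
C⋆-algebras. In diagrammatic order, `F ⋙ tensoring A` is the functor `B ↦ A ⊗ F B`, and
`tensoring A ⋙ F` is the functor `B ↦ F (A ⊗ B)`. -/
structure IsLabeling (F : CStarCat.{u} ⥤ CStarCat.{u})
    (κ : ∀ A : CStarCat.{u}, F ⋙ tensoring A ⟶ tensoring A ⋙ F) : Prop where
  /-- Compatibility with the natural transformations `𝔇_φ`. -/
  natural : ∀ {A A' : CStarCat.{u}} (φ : A ⟶ A') (B : CStarCat.{u}),
    (κ A).app B ≫ F.map ((tensoringMap φ).app B) =
      (tensoringMap φ).app (F.obj B) ≫ (κ A').app B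
  /-- Compatibility with `𝔇²`. -/
  mul : ∀ A A' B : CStarCat.{u},
    (tensoring A).map ((κ A').app B) ≫ (κ A).app ((tensoring A').obj B) ≫
        F.map ((tensoringMul A A').app B) =
      (tensoringMul A A').app (F.obj B) ≫ (κ (tensor A A')).app B
  /-- Compatibility with `𝔇⁰`. -/
  one : ∀ B : CStarCat.{u},
    tensoringUnit.app (F.obj B) ≫ (κ unit).app B = F.map (tensoringUnit.app B)

/-- Labeled endofunctors of the category of C⋆-algebras. -/
structure LEFC : Type (u + 1) where
  functor : CStarCat.{u} ⥤ CStarCat.{u}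
  label : ∀ A : CStarCat.{u}, functor ⋙ tensoring A ⟶ tensoring A ⋙ functor
  isLabeling : IsLabeling functor label

namespace LEFC

/-- A labeled natural transformation: a natural transformation compatible with the labelings. -/
@[ext]
structure Hom (F G : LEFC.{u}) : Type (u + 1) where
  natTrans : F.functor ⟶ G.functor
  labeled : ∀ A B : CStarCat.{u},
    (F.label A).app B ≫ natTrans.app ((tensoring A).obj B) =
      (tensoring A).map (natTrans.app B) ≫ (G.label A).app B

/-- The category of labeled endofunctors and labeled natural transformations. -/
instance : Category.{u + 1} LEFC.{u} where
  Hom := Hom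
  id F := ⟨𝟙 F.functor, fun A B => by simp⟩
  comp α β := ⟨α.natTrans ≫ β.natTrans, fun A B => by
    rw [NatTrans.comp_app, NatTrans.comp_app, Functor.map_comp, Category.assoc, ← β.labeled A B,
      ← Category.assoc, ← Category.assoc, α.labeled A B]⟩
  id_comp _ := Hom.ext (Category.id_comp _)
  comp_id _ := Hom.ext (Category.comp_id _)
  assoc _ _ _ := Hom.ext (Category.assoc _ _ _)

/-- The functor that forgets the labeling. -/
abbrev forget : LEFC.{u} ⥤ (CStarCat.{u} ⥤ CStarCat.{u}) where
  obj F := F.functor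
  map α := α.natTrans

end LEFC

/-! ### Good endofunctors -/

/-- An endofunctor of the category of C⋆-algebras is decent if it preserves pullbacks along split
epimorphisms and the terminal object `0`. -/
structure IsDecent (F : CStarCat.{u} ⥤ CStarCat.{u}) : Prop where
  pullback : ∀ {B₁ B₂ B : CStarCat.{u}} (φ₁ : B₁ ⟶ B) (φ₂ : B₂ ⟶ B),
    IsSplitEpi φ₂ → PreservesLimit (cospan φ₁ φ₂) F
  terminal : PreservesLimit (Functor.empty.{0} CStarCat.{u}) F

/-- The category of good endofunctors, that is, labeled endofunctors whose underlying endofunctor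
is decent, and labeled natural transformations. -/
abbrev GEFC : Type (u + 1) :=
  ObjectProperty.FullSubcategory (C := LEFC.{u}) fun F => IsDecent F.functor

/-- The functor that sends a good endofunctor to its underlying endofunctor. -/
abbrev GEFC.underlying : GEFC.{u} ⥤ (CStarCat.{u} ⥤ CStarCat.{u}) :=
  ObjectProperty.ι _ ⋙ LEFC.forget

end

noncomputable section

open CStarCat

/-! ### Limits of C⋆-algebras -/

namespace CStarCat

/-! Everything is reduced to limits of C⋆-algebras, which are built by hand: inside the ℓ^∞-product
of a diagram, the compatible families form a closed ⋆-subalgebra. Cones factor through it because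
⋆-homomorphisms are contractive, so the family of images of one element is bounded. Hence limits of
endofunctors exist and are computed pointwise.

Let `F_∞` be a pointwise limit of good endofunctors `F_j`. The maps `A ⊗ F_∞ B ⟶ A ⊗ F_j B ⟶ F_j (A
⊗ B)` form a cone, because the transition maps are labeled. As `F_∞ (A ⊗ B)` is a limit, there is
exactly one candidate for the labeling (`limitLabel`). Each labeling axiom is an equation between
maps into a value of `F_∞`. It can be tested after every projection, where it becomes the axiom for
`F_j` (`isLabeling_limitLabel`). The functor `A ⊗ _` need not preserve any limit, since the limit
property is only used in the target.

Decency passes to `F_∞` because limits commute with limits (`preservesLimit_of_pointwise_isLimit`).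
Finally, a cone in `GEFC` factors uniquely at the level of natural transformations, and this
factorization is labeled, again by testing after the projections (`GEFC.isLimitLimitCone`). -/

theorem hom_ext {A B : CStarCat.{u}} {f g : A ⟶ B} (h : ∀ a, f.hom a = g.hom a) : f = g :=
  Hom.ext (NonUnitalStarAlgHom.ext h)

variable {J : Type u} [SmallCategory J] (F : J ⥤ CStarCat.{u})

/-- The evaluation `⋆`-homomorphism at `j` on the C⋆-algebra of bounded families. -/
def boundedFamilyEval (j : J) : lp (fun j => (F.obj j).carrier) ⊤ →⋆ₙₐ[ℂ] (F.obj j).carrier where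
  toFun x := x j
  map_smul' _ _ := rfl
  map_zero' := rfl
  map_add' _ _ := rfl
  map_mul' _ _ := rfl
  map_star' _ := rfl

/-- The bounded families that are compatible with the transition maps of a diagram. -/
def compatibleFamilies : NonUnitalStarSubalgebra ℂ (lp (fun j => (F.obj j).carrier) ⊤) where
  carrier := {x | ∀ ⦃i j : J⦄ (f : i ⟶ j), (F.map f).hom (boundedFamilyEval F i x) =
    boundedFamilyEval F j x}
  zero_mem' i j f := by simp only [map_zero]
  add_mem' hx hy i j f := by simp only [map_add, hx f, hy f]
  mul_mem' hx hy i j f := by simp only [map_mul, hx f, hy f]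
  smul_mem' c x hx i j f := by simp only [map_smul, hx f]
  star_mem' hx i j f := by simp only [StarHomClass.map_star, hx f]

/-- The subalgebra is an intersection of equalizers of ⋆-homomorphisms, which are continuous.
Closedness gives completeness; as an instance it lets the subalgebra be recognized as a C⋆-algebra.
-/
instance isClosed_compatibleFamilies : 
    IsClosed (compatibleFamilies F : Set (lp (fun j => (F.obj j).carrier) ⊤)) := by
  have : (compatibleFamilies F : Set (lp (fun j => (F.obj j).carrier) ⊤)) =
      ⋂ (i : J) (j : J) (f : i ⟶ j), {x | (F.map f).hom (boundedFamilyEval F i x) =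
        boundedFamilyEval F j x} := by
    ext x
    simp only [Set.mem_iInter]
    rfl
  rw [this]
  exact isClosed_iInter fun i => isClosed_iInter fun j => isClosed_iInter fun f =>
    isClosed_eq ((continuous_hom _).comp (continuous_hom _)) (continuous_hom _)

/-- The limit cone of a diagram of C⋆-algebras, given by the bounded compatible families. -/
def limitCone : Cone F where
  pt := ⟨compatibleFamilies F⟩
  π :=
    { app j := ⟨(boundedFamilyEval F j).comp
        (NonUnitalStarSubalgebraClass.subtype (compatibleFamilies F))⟩
      naturality _ _ f := hom_ext fun x => (x.2 f).symm }

/-- The map into the bounded compatible families that is induced by a cone. -/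
def limitLift (s : Cone F) : s.pt ⟶ (limitCone F).pt := ⟨
  { toFun a := ⟨⟨fun j => (s.π.app j).hom a, memℓp_infty
        -- The bound `‖a‖` is uniform in `j` because every leg is contractive.
        ⟨‖a‖, by rintro _ ⟨j, rfl⟩; exact NonUnitalStarAlgHom.norm_apply_le (s.π.app j).hom a⟩⟩,
      fun i j f => congrArg (fun g : s.pt ⟶ F.obj j => g.hom a) (s.w f)⟩
    map_smul' c a := Subtype.ext (lp.ext (funext fun j => map_smul (s.π.app j).hom c a))
    map_zero' := Subtype.ext (lp.ext (funext fun j => map_zero (s.π.app j).hom))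
    map_add' a b := Subtype.ext (lp.ext (funext fun j => map_add (s.π.app j).hom a b))
    map_mul' a b := Subtype.ext (lp.ext (funext fun j => map_mul (s.π.app j).hom a b))
    map_star' a := Subtype.ext (lp.ext (funext fun j =>
      StarHomClass.map_star (s.π.app j).hom a)) }⟩

/-- The bounded compatible families form a limit cone. -/
def isLimitLimitCone : IsLimit (limitCone F) where
  lift := limitLift F
  fac _ _ := rfl
  uniq s _ h := hom_ext fun a => Subtype.ext (lp.ext (funext fun j =>
    congrArg (fun g : s.pt ⟶ F.obj j => g.hom a) (h j)))

/-- The index category lies in the universe `u`, so that the bounded families over it form a type in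
`u` again. -/
instance : HasLimitsOfSize.{u, u} CStarCat.{u} where
  has_limits_of_shape _ _ := ⟨fun F => ⟨⟨limitCone F, isLimitLimitCone F⟩⟩⟩

end CStarCat

/-! ### Pointwise limits of functors -/

section Pointwise

universe v₁ v₂ v₃ v₄ u₁ u₂ u₃ u₄

variable {J : Type u₁} [Category.{v₁} J] {C : Type u₂} [Category.{v₂} C]
  {D : Type u₃} [Category.{v₃} D] {K : Type u₄} [Category.{v₄} K]

/-- A pointwise limit of functors that preserve the limit of `G` preserves the limit of `G`. -/
theorem preservesLimit_of_pointwise_isLimit {F : J ⥤ C ⥤ D} (c : Cone F)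
    (hc : ∀ X, IsLimit (((evaluation C D).obj X).mapCone c)) (G : K ⥤ C)
    (h : ∀ j, PreservesLimit G (F.obj j)) : PreservesLimit G c.pt where
  preserves {s} hs := by
    have hj : ∀ j, IsLimit ((F.obj j).mapCone s) := fun j => isLimitOfPreserves _ hs
    -- Pushing a cone `t` along the `j`-th leg of `c` gives a cone over `G ⋙ F.obj j`, which factors
    -- through the limit cone `(F.obj j).mapCone s`.
    let p (t : Cone (G ⋙ c.pt)) (j : J) : Cone (G ⋙ F.obj j) :=
      (Cone.postcompose (Functor.whiskerLeft G (c.π.app j))).obj t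
    have hp : ∀ t j k, (hj j).lift (p t j) ≫ (F.obj j).map (s.π.app k) =
        t.π.app k ≫ (c.π.app j).app (G.obj k) := fun t j k => (hj j).fac (p t j) k
    -- The factorizations for varying `j` are compatible, as one sees after composing with the legs
    -- of `s`. They therefore assemble to a map from `t.pt` into the pointwise limit at `s.pt`.
    let q (t : Cone (G ⋙ c.pt)) : Cone (F ⋙ (evaluation C D).obj s.pt) :=
      { pt := t.pt
        π :=
          { app j := (hj j).lift (p t j)
            naturality i j f := (hj j).hom_ext fun k => by
              have hw := congrArg (fun α => NatTrans.app α (G.obj k)) (c.w f)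
              dsimp at hw ⊢
              simp only [Category.id_comp, Category.assoc]
              rw [hp, ← (F.map f).naturality, ← Category.assoc, hp, Category.assoc, hw] } }
    have hq : ∀ t j, (hc s.pt).lift (q t) ≫ (c.π.app j).app s.pt = (hj j).lift (p t j) :=
      fun t j => (hc s.pt).fac (q t) j
    -- The factorization identity at `k` is tested on the components `j` of the limit at `G.obj k`.
    -- For uniqueness, maps into the limit at `s.pt` are tested on the components `j` and then on
    -- the legs `k`.
    refine ⟨⟨fun t => (hc s.pt).lift (q t), fun t k => (hc (G.obj k)).hom_ext fun j => ?_,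
      fun t m hm => (hc s.pt).hom_ext fun j => (hj j).hom_ext fun k => ?_⟩⟩
    · dsimp
      rw [Category.assoc]
      refine (congrArg (_ ≫ ·) ((c.π.app j).naturality (s.π.app k))).trans ?_
      refine (Category.assoc _ _ _).symm.trans ?_
      exact (congrArg (· ≫ _) (hq t j)).trans (hp t j k)
    · dsimp
      rw [hq, hp, Category.assoc]
      refine (congrArg (m ≫ ·) ((c.π.app j).naturality (s.π.app k)).symm).trans ?_
      exact (Category.assoc _ _ _).symm.trans (congrArg (· ≫ _) (hm k))

end Pointwise

/-- Both clauses of decency ask for the preservation of particular limits, so commutation of limits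
with limits applies to each. -/
theorem IsDecent.of_pointwise_isLimit {J : Type*} [Category* J]
    {F : J ⥤ CStarCat.{u} ⥤ CStarCat.{u}} (c : Cone F)
    (hc : ∀ B, IsLimit (((evaluation CStarCat.{u} CStarCat.{u}).obj B).mapCone c))
    (h : ∀ j, IsDecent (F.obj j)) : IsDecent c.pt where
  pullback φ₁ φ₂ hφ :=
    preservesLimit_of_pointwise_isLimit c hc _ fun j => (h j).pullback φ₁ φ₂ hφ
  terminal := preservesLimit_of_pointwise_isLimit c hc _ fun j => (h j).terminal

/-! ### Pointwise limits of labeled endofunctors -/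

namespace LEFC

variable {J : Type*} [Category* J] {F : J ⥤ LEFC.{u}} (c : Cone (F ⋙ forget))

/-- The cone with legs `A ⊗ F_∞ B ⟶ A ⊗ F_j B ⟶ F_j (A ⊗ B)`. -/
def labelCone (A B : CStarCat.{u}) :
    Cone ((F ⋙ forget) ⋙ (evaluation CStarCat.{u} CStarCat.{u}).obj (A.tensoring.obj B)) where
  pt := A.tensoring.obj (c.pt.obj B)
  π :=
    { app j := A.tensoring.map ((c.π.app j).app B) ≫ ((F.obj j).label A).app B
      -- The label is moved past the transition map `F.map f` because the latter is labeled; then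
      -- `c.w f` is applied under `A ⊗ _`.
      naturality i j f := by
        have hw := congrArg (fun α => NatTrans.app α B) (c.w f)
        dsimp at hw ⊢
        rw [Category.id_comp, Category.assoc, (F.map f).labeled, ← Category.assoc,
          ← Functor.map_comp, hw] }

variable {c}

theorem cone_naturality (j : J) {B B' : CStarCat.{u}} (g : B ⟶ B') :
    c.pt.map g ≫ (c.π.app j).app B' = (c.π.app j).app B ≫ (F.obj j).functor.map g :=
  (c.π.app j).naturality g

/-- Joint monicity of the legs at each object: the device that reduces equations about the limit to
equations about each `F_j`. -/
theorem hom_ext_of_pointwise_isLimit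
    (hc : ∀ B, IsLimit (((evaluation CStarCat.{u} CStarCat.{u}).obj B).mapCone c)) {X B : CStarCat.{u}} {f g : X ⟶ c.pt.obj B}
    (h : ∀ j, f ≫ (c.π.app j).app B = g ≫ (c.π.app j).app B) : f = g :=
  (hc B).hom_ext h

variable (hc : ∀ B, IsLimit (((evaluation CStarCat.{u} CStarCat.{u}).obj B).mapCone c))

/-- The component of the labeling of a pointwise limit. -/
def limitLabelApp (A B : CStarCat.{u}) :
    A.tensoring.obj (c.pt.obj B) ⟶ c.pt.obj (A.tensoring.obj B) :=
  (hc (A.tensoring.obj B)).lift (labelCone c A B)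

theorem limitLabelApp_π (j : J) (A B : CStarCat.{u}) :
    limitLabelApp hc A B ≫ (c.π.app j).app (A.tensoring.obj B) =
      A.tensoring.map ((c.π.app j).app B) ≫ ((F.obj j).label A).app B :=
  (hc (A.tensoring.obj B)).fac (labelCone c A B) j

/-- The labeling of a pointwise limit of labeled endofunctors. -/
def limitLabel (A : CStarCat.{u}) : c.pt ⋙ A.tensoring ⟶ A.tensoring ⋙ c.pt where
  app B := limitLabelApp hc A B
  -- After projection to `F_j`, this is naturality of the label of `F_j` combined with naturality of
  -- the leg under `A ⊗ _`.
  naturality B B' g := hom_ext_of_pointwise_isLimit hc fun j => by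
    have h := ((F.obj j).label A).naturality g
    dsimp at h ⊢
    rw [Category.assoc, Category.assoc, limitLabelApp_π, cone_naturality,
      ← Category.assoc (limitLabelApp hc A B), limitLabelApp_π, Category.assoc, ← h,
      ← Category.assoc, ← Category.assoc, ← Functor.map_comp, ← Functor.map_comp,
      cone_naturality]

theorem limitLabel_π (j : J) (A B : CStarCat.{u}) :
    (limitLabel hc A).app B ≫ (c.π.app j).app (A.tensoring.obj B) =
      A.tensoring.map ((c.π.app j).app B) ≫ ((F.obj j).label A).app B :=
  limitLabelApp_π hc j A B

/-- The hypothesis prescribes the composite of each component with every leg at `A ⊗ B`, and these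
legs are jointly monic. -/
theorem limitLabel_unique (κ : ∀ A : CStarCat.{u}, c.pt ⋙ A.tensoring ⟶ A.tensoring ⋙ c.pt)
    (h : ∀ (j : J) (A B : CStarCat.{u}),
      (κ A).app B ≫ (c.π.app j).app (A.tensoring.obj B) =
        A.tensoring.map ((c.π.app j).app B) ≫ ((F.obj j).label A).app B) :
    κ = limitLabel hc :=
  funext fun A => NatTrans.ext <| funext fun B => hom_ext_of_pointwise_isLimit hc fun j =>
    (h j A B).trans (limitLabel_π hc j A B).symm

/-- After composition with a leg, `limitLabel_π` replaces the labels of the limit by those of `F_j`,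
and the leg is carried past `𝔇_φ`, `𝔇²` and `𝔇⁰` by their naturality. What remains is the axiom for
`F_j`. -/
theorem isLabeling_limitLabel : IsLabeling c.pt (limitLabel hc) where
  natural {A A'} φ B := hom_ext_of_pointwise_isLimit hc fun j => by
    have h := (F.obj j).isLabeling.natural φ B
    have h' := (tensoringMap φ).naturality ((c.π.app j).app B)
    rw [Category.assoc, Category.assoc, limitLabel_π, cone_naturality,
      ← Category.assoc, limitLabel_π, Category.assoc, h, ← Category.assoc, ← Category.assoc]
    exact congrArg (· ≫ _) h'
  mul A A' B := hom_ext_of_pointwise_isLimit hc fun j => by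
    have h := (F.obj j).isLabeling.mul A A' B
    have h' := (tensoringMul A A').naturality ((c.π.app j).app B)
    have e := cone_naturality (c := c) j ((tensoringMul A A').app B)
    have l := limitLabel_π hc j A (A'.tensoring.obj B)
    -- The inner label occurs under `A ⊗ _`, so its projection formula is needed after applying this
    -- functor.
    have l' := congrArg A.tensoring.map (limitLabel_π hc j A' B)
    have l'' := limitLabel_π hc j (tensor A A') B
    rw [Functor.map_comp, Functor.map_comp] at l'
    -- The leg travels from the right end to the left: past the image of `𝔇²`, the outer label and
    -- the inner label. Then the axiom for `F_j` applies, and the leg returns past `𝔇²` and the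
    -- label for `A ⊗ A'`.
    calc _ = A.tensoring.map ((limitLabel hc A').app B) ≫
          ((limitLabel hc A).app (A'.tensoring.obj B) ≫
            (c.π.app j).app (A.tensoring.obj (A'.tensoring.obj B))) ≫
              (F.obj j).functor.map ((tensoringMul A A').app B) := by
            simp only [Category.assoc]
            exact congrArg (fun z => _ ≫ _ ≫ z) e
      _ = (A.tensoring.map ((limitLabel hc A').app B) ≫
            A.tensoring.map ((c.π.app j).app (A'.tensoring.obj B))) ≫
            ((F.obj j).label A).app (A'.tensoring.obj B) ≫
              (F.obj j).functor.map ((tensoringMul A A').app B) := by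
            rw [l]; simp only [Category.assoc]
      _ = A.tensoring.map (A'.tensoring.map ((c.π.app j).app B)) ≫
            (tensoringMul A A').app ((F.obj j).functor.obj B) ≫
              ((F.obj j).label (tensor A A')).app B := by
            rw [l', ← h]; simp only [Category.assoc]
      _ = ((tensoringMul A A').app (c.pt.obj B) ≫
            (tensor A A').tensoring.map ((c.π.app j).app B)) ≫
              ((F.obj j).label (tensor A A')).app B := by
            exact (Category.assoc _ _ _).symm.trans (congrArg (· ≫ _) h')
      _ = _ := by simp only [Category.assoc]; rw [l'']
  one B := hom_ext_of_pointwise_isLimit hc fun j => by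
    have h := (F.obj j).isLabeling.one B
    have h' := tensoringUnit.naturality ((c.π.app j).app B)
    have e := cone_naturality (c := c) j (tensoringUnit.app B)
    rw [Category.assoc, limitLabel_π, ← Category.assoc]
    refine Eq.trans ?_ e.symm
    refine Eq.trans (congrArg (· ≫ _) h'.symm) ?_
    rw [Category.assoc]
    exact congrArg (_ ≫ ·) h

end LEFC

/-! ### Limits of good endofunctors -/

namespace GEFC

variable {J : Type*} [Category* J] {F : J ⥤ GEFC.{u}} {c : Cone (F ⋙ underlying)}
  (hc : ∀ B, IsLimit (((evaluation CStarCat.{u} CStarCat.{u}).obj B).mapCone c))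

/-- The labeling of a pointwise limit of good endofunctors. -/
abbrev limitLabel (A : CStarCat.{u}) : c.pt ⋙ A.tensoring ⟶ A.tensoring ⋙ c.pt :=
  LEFC.limitLabel (F := F ⋙ ObjectProperty.ι _) (c := c) hc A

theorem isLabeling_limitLabel : IsLabeling c.pt (limitLabel hc) :=
  LEFC.isLabeling_limitLabel (F := F ⋙ ObjectProperty.ι _) (c := c) hc

theorem isDecent_pt
    (hc : ∀ B, IsLimit (((evaluation CStarCat.{u} CStarCat.{u}).obj B).mapCone c)) :
    IsDecent c.pt :=
  IsDecent.of_pointwise_isLimit c hc fun j => (F.obj j).property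

/-- The pointwise limit cone in the category of good endofunctors. -/
def limitCone : Cone F where
  pt := ⟨⟨c.pt, limitLabel hc, isLabeling_limitLabel hc⟩, isDecent_pt hc⟩
  π :=
    { app j := ObjectProperty.homMk ⟨c.π.app j, fun A B =>
        LEFC.limitLabel_π (F := F ⋙ ObjectProperty.ι _) (c := c) hc j A B⟩
      naturality _ _ f := ObjectProperty.hom_ext _ (LEFC.Hom.ext (c.π.naturality f)) }

/-- A pointwise limit cone of good endofunctors is a limit cone. -/
def isLimitLimitCone : IsLimit (limitCone hc) :=
  -- The factorization is taken in the functor category; only its being labeled remains to be shown.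
  have hl : IsLimit c := evaluationJointlyReflectsLimits c hc
  have hfac : ∀ (s : Cone F) (j : J) (B : CStarCat.{u}),
      (hl.lift (underlying.mapCone s)).app B ≫ (c.π.app j).app B =
        (s.π.app j).hom.natTrans.app B := fun s j B =>
    congrArg (fun α => NatTrans.app α B) (hl.fac (underlying.mapCone s) j)
  { lift s := ObjectProperty.homMk ⟨hl.lift (underlying.mapCone s), fun A B =>
      -- After the `j`-th projection, the condition says that the leg `s.π.app j` is labeled.
      (hc _).hom_ext fun j => by
        have h := (s.π.app j).hom.labeled A B
        have l := LEFC.limitLabel_π (F := F ⋙ ObjectProperty.ι _) (c := c) hc j A B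
        refine (Category.assoc _ _ _).trans (Eq.trans (congrArg (_ ≫ ·) (hfac s j _)) ?_)
        refine h.trans (Eq.trans ?_ (Category.assoc _ _ _).symm)
        refine Eq.trans ?_ (congrArg (_ ≫ ·) l.symm)
        rw [← hfac s j B, Functor.map_comp, Category.assoc]
        rfl⟩
    -- Labeled transformations are determined by their underlying transformations, so both
    -- properties are inherited from `hl`.
    fac s j := ObjectProperty.hom_ext _ (LEFC.Hom.ext (hl.fac (underlying.mapCone s) j))
    uniq s m h := ObjectProperty.hom_ext _ (LEFC.Hom.ext
      (hl.uniq (underlying.mapCone s) m.hom.natTrans fun j =>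
        congrArg (fun f => f.hom.natTrans) (h j))) }

/-- The pointwise limit cone of a diagram of good endofunctors evaluates to limit cones. -/
def evaluationLimit {J : Type u} [SmallCategory J] (F : J ⥤ GEFC.{u}) (B : CStarCat.{u}) :
    IsLimit (((evaluation CStarCat.{u} CStarCat.{u}).obj B).mapCone
      (limit.cone (F ⋙ underlying))) :=
  isLimitOfPreserves _ (limit.isLimit _)

end GEFC

end

/-- Since the forgetful functor to endofunctors is faithful, `GEFC.underlying.mapCone c' = c` says
that the legs of the limit cone `c'` are the given `pr_j`. -/
theorem proposition4p20 :
    HasLimitsOfSize.{u, u} GEFC.{u} ∧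
    (∀ B : CStarCat.{u}, PreservesLimitsOfSize.{u, u}
      (GEFC.underlying.{u} ⋙ (evaluation CStarCat.{u} CStarCat.{u}).obj B)) ∧
    ∀ (J : Type u) [SmallCategory J] (F : J ⥤ GEFC.{u}) (c : Cone (F ⋙ GEFC.underlying)),
      (∀ B : CStarCat.{u}, Nonempty
        (IsLimit (((evaluation CStarCat.{u} CStarCat.{u}).obj B).mapCone c))) →
      ∃ κ : ∀ A : CStarCat.{u}, c.pt ⋙ A.tensoring ⟶ A.tensoring ⋙ c.pt,
        (∀ (j : J) (A B : CStarCat.{u}),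
          (κ A).app B ≫ (c.π.app j).app (A.tensoring.obj B) =
            A.tensoring.map ((c.π.app j).app B) ≫ ((F.obj j).obj.label A).app B) ∧
        (∀ κ' : ∀ A : CStarCat.{u}, c.pt ⋙ A.tensoring ⟶ A.tensoring ⋙ c.pt,
          (∀ (j : J) (A B : CStarCat.{u}),
            (κ' A).app B ≫ (c.π.app j).app (A.tensoring.obj B) =
              A.tensoring.map ((c.π.app j).app B) ≫ ((F.obj j).obj.label A).app B) →
          κ' = κ) ∧
        ∃ (hκ : IsLabeling c.pt κ) (hd : IsDecent c.pt) (c' : Cone F),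
          c'.pt = ⟨⟨c.pt, κ, hκ⟩, hd⟩ ∧ GEFC.underlying.mapCone c' = c ∧
            Nonempty (IsLimit c') := by
  refine ⟨⟨fun J _ => ⟨fun F => ⟨⟨_, GEFC.isLimitLimitCone (GEFC.evaluationLimit F)⟩⟩⟩⟩,
    -- Preservation need only be checked on one limit cone per diagram; the explicit one evaluates
    -- to a limit cone by construction.
    fun B => ⟨fun {J} _ => ⟨fun {F} => preservesLimit_of_preserves_limit_cone
      (GEFC.isLimitLimitCone (GEFC.evaluationLimit F)) (GEFC.evaluationLimit F B)⟩⟩, ?_⟩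
  intro J _ F c hc
  -- The choice is harmless, since the resulting labeling is unique.
  have hc' := fun B => (hc B).some
  exact ⟨GEFC.limitLabel hc',
    LEFC.limitLabel_π (F := F ⋙ ObjectProperty.ι _) (c := c) hc',
    LEFC.limitLabel_unique (F := F ⋙ ObjectProperty.ι _) (c := c) hc',
    GEFC.isLabeling_limitLabel hc', GEFC.isDecent_pt hc', GEFC.limitCone hc', rfl, rfl,
    ⟨GEFC.isLimitLimitCone hc'⟩⟩
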